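/- A clause is a finite set of literals (variables or negated variables), and a CNF formula is a finite set of clauses. For positive integers $k$ and integers $s\ge 0$, a $(k,s)$-CNF formula is a CNF formula in which every clause consists of exactly $k$ distinct literals and every variable occurs (negated or not) in at most $s$ clauses. A CNF formula is minimal unsatisfiable if it is unsatisfiable but each of its proper subsets is satisfiable; $\mathrm{MU}(1)$ is the class of minimal unsatisfiable CNF formulas $\mathcal F$ with $m(\mathcal F)-n(\mathcal F)=1$, where $m(\mathcal F)$ is the number of clauses of $\mathcal F$ and $n(\mathcal F)$ is the number of variables occurring in $\mathcal F$. For $k\ge 1$ let $$f(k):=\max\{s:\text{every }(k,s)\text{-CNF formula is satisfiable}\},$$ $$f_1(k):=\max\{s:\text{every }(k,s)\text{-CNF formula in }\mathrm{MU}(1)\text{ is satisfiable}\}.$$ Then both maxima exist for every $k\ge 1$, and the following hold. 1. For all sufficiently large $k$ we have $f_1(k)\le 2\cdot\frac{2^k}{k}$. 2. $f(k)=\Theta\!\left(\frac{2^k}{k}\right)$ and $f_1(k)=\Theta\!\left(\frac{2^k}{k}\right)$ as $k\to\infty$. 3. For infinitely many $k$ we have $f_1(k)\le\frac{2^k}{k}$.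 -/

import Mathlib

open Filter Asymptotics

namespace KSCNF

/-- A literal over the variables `x₀, x₁, x₂, …`: the pair `(i, true)` is the literal `xᵢ`, and
`(i, false)` is its negation. -/
abbrev Literal : Type := ℕ × Bool

/-- A clause is a finite set of (hence distinct) literals, read as their disjunction. -/
abbrev Clause : Type := Finset Literal

/-- A formula in conjunctive normal form is a finite set of clauses, read as their conjunction. -/
abbrev Formula : Type := Finset Clause

/-- The set of variables that occur in the clause `C`. -/
def Clause.vars (C : Clause) : Finset ℕ := C.image Prod.fst

/-- The set of variables that occur in the formula `F`. -/
def Formula.vars (F : Formula) : Finset ℕ := F.biUnion Clause.vars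

/-- The number of clauses of `F` in which the variable `x` occurs (positively or negated). -/
def Formula.occ (F : Formula) (x : ℕ) : ℕ := (F.filter fun C => x ∈ Clause.vars C).card

/-- Some truth assignment makes at least one literal of every clause of `F` true. -/
def Formula.Satisfiable (F : Formula) : Prop :=
  ∃ τ : ℕ → Bool, ∀ C ∈ F, ∃ l ∈ C, τ l.1 = l.2

/-- `F` is a `(k, s)`-CNF formula: every clause has exactly `k` literals, and every variable
occurs in at most `s` clauses. -/
def Formula.IsKS (k s : ℕ) (F : Formula) : Prop :=
  (∀ C ∈ F, C.card = k) ∧ ∀ x : ℕ, Formula.occ F x ≤ s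

/-- `F` is minimal unsatisfiable: it is unsatisfiable, and every proper subformula is
satisfiable. -/
def Formula.MinimalUnsat (F : Formula) : Prop :=
  ¬ Formula.Satisfiable F ∧ ∀ G : Formula, G ⊂ F → Formula.Satisfiable G

/-- The class MU(1): minimal unsatisfiable formulas whose number of clauses exceeds the number of
their variables by exactly one. -/
def Formula.MU1 (F : Formula) : Prop :=
  Formula.MinimalUnsat F ∧ F.card = (Formula.vars F).card + 1

/-- The set of all `s` such that every `(k, s)`-CNF formula is satisfiable. -/
def satBounds (k : ℕ) : Set ℕ :=
  {s | ∀ F : Formula, Formula.IsKS k s F → Formula.Satisfiable F}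

/-- The set of all `s` such that every `(k, s)`-CNF formula in MU(1) is satisfiable. -/
def satBoundsMU1 (k : ℕ) : Set ℕ :=
  {s | ∀ F : Formula, Formula.IsKS k s F → Formula.MU1 F → Formula.Satisfiable F}

/-- `f(k)`, the largest `s` such that every `(k, s)`-CNF formula is satisfiable. -/
noncomputable def f (k : ℕ) : ℕ := sSup (satBounds k)

/-- `f₁(k)`, the largest `s` such that every `(k, s)`-CNF formula in MU(1) is satisfiable. -/
noncomputable def f₁ (k : ℕ) : ℕ := sSup (satBoundsMU1 k)

end KSCNF

/-! The upper bounds rest on `f₁_le`: `f₁ k ≤ 2 ^ (k - s)` if `2 ^ s ≤ k` and `20 ≤ s`. With `s` the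
integer part of `log₂ k` this loses at most a factor 2 against `2 ^ k / k`, and nothing when `k = 2
^ s`.

Give each internal node of a binary tree a variable, label its two outgoing edges with the two
literals, and let each leaf contribute the clause of the last `k` edges above it. If no leaf has
depth below `k` and every internal node has at most `d` leaves within distance `k` below it, this is
an unsatisfiable `(k, d)`-formula; a minimal such subtree yields one in MU(1)
(`Constructible.exists_mu1`).

The tree is grown from vectors of leaf budgets. Splitting a budget evenly makes room for `d / 2` new
leaves at depth `k` in each generation. For `d = 2 ^ (k - s)` and `k = 2 ^ s`, even splitting alone
ends with Kraft sum about `k / 2 ^ (s + 1) = 1 / 2`, half of what `Constructible.of_kraft` needs.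
Uneven splitting recovers the factor 2 (`Constructible.of_profile`): some descendants take the
lowest budgets and finish, and the others share the higher budgets at greater density before being
halved again. The density grows until all descendants finish.

The lower bound on `f` is Rosenfeld's counting argument (`mul_card_satSets_le`) with growth factor
`2 - 1 / k`. As `f k ≤ f₁ k`, both orders of magnitude follow. -/

namespace KSCNF

/-! ### Bounded trees, leaf budgets, Kraft's inequality and halving. -/

/-- Finite binary trees in which every internal node has two children. -/
inductive BTree : Type
  | leaf : BTree
  | node : BTree → BTree → BTree

/-- The number of leaves at depth `i`. -/
def BTree.leavesAt : BTree → ℕ → ℕ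
  | .leaf, 0 => 1
  | .leaf, _ + 1 => 0
  | .node _ _, 0 => 0
  | .node l r, i + 1 => l.leavesAt i + r.leavesAt i

/-- Every internal node has at most `d` leaves within distance `k` below it. -/
def BTree.Bounded (k d : ℕ) : BTree → Prop
  | .leaf => True
  | .node l r => (∑ i ∈ Finset.range (k + 1), (BTree.node l r).leavesAt i) ≤ d ∧
      l.Bounded k d ∧ r.Bounded k d

/-- Some `(k, d)`-bounded tree has at most `x i` leaves at each depth `i ≤ k`. -/
def Constructible (k d : ℕ) (x : ℕ → ℕ) : Prop :=
  ∃ T : BTree, T.Bounded k d ∧ ∀ i ≤ k, T.leavesAt i ≤ x i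

/-- The leaf budget after `t` generations of halving, where the new entries are as large as the
bound `d` permits. -/
def halve (k d t : ℕ) (x : ℕ → ℕ) (i : ℕ) : ℕ :=
  if i + t ≤ k then x (i + t) / 2 ^ t else d / 2 ^ (k + 1 - i)

namespace Constructible

variable {k d : ℕ} {x y z : ℕ → ℕ}

theorem mono (h : Constructible k d x) (hxy : ∀ i ≤ k, x i ≤ y i) : Constructible k d y :=
  h.imp fun _ hT => ⟨hT.1, fun i hi => (hT.2 i hi).trans (hxy i hi)⟩

theorem of_leaf (h : 1 ≤ x 0) : Constructible k d x :=
  ⟨.leaf, trivial, fun i _ => by cases i <;> simp [BTree.leavesAt, h]⟩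

theorem of_node (hy : Constructible k d y) (hz : Constructible k d z)
    (hyz : ∀ i < k, y i + z i ≤ x (i + 1)) (hx : ∑ i ∈ Finset.range (k + 1), x i ≤ d) :
    Constructible k d x := by
  obtain ⟨T, hT, hTy⟩ := hy
  obtain ⟨U, hU, hUz⟩ := hz
  have key : ∀ i ≤ k, (BTree.node T U).leavesAt i ≤ x i := by
    rintro (_ | i) hi
    · simp [BTree.leavesAt]
    · have h1 := hTy i (by omega)
      have h2 := hUz i (by omega)
      have h3 := hyz i (by omega)
      simp only [BTree.leavesAt]
      omega
  refine ⟨.node T U, ⟨le_trans (Finset.sum_le_sum fun i hi => key i ?_) hx, hT, hU⟩, key⟩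
  have := Finset.mem_range.1 hi
  omega

end Constructible

/-- If the Kraft sum is at least one, some subvector has Kraft sum exactly one. -/
theorem exists_le_kraft_eq (m : ℕ) (x : ℕ → ℕ)
    (h : 2 ^ m ≤ ∑ i ∈ Finset.range (m + 1), x i * 2 ^ (m - i)) :
    ∃ y : ℕ → ℕ, (∀ i, y i ≤ x i) ∧ ∑ i ∈ Finset.range (m + 1), y i * 2 ^ (m - i) = 2 ^ m := by
  have dbl : ∀ (m : ℕ) (u : ℕ → ℕ), ∑ i ∈ Finset.range (m + 1), u i * 2 ^ (m + 1 - i) =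
      2 * ∑ i ∈ Finset.range (m + 1), u i * 2 ^ (m - i) := by
    intro m u
    rw [Finset.mul_sum]
    refine Finset.sum_congr rfl fun i hi => ?_
    have := Finset.mem_range.1 hi
    rw [show m + 1 - i = (m - i) + 1 by omega, pow_succ]
    ring
  induction m with
  | zero =>
    have h0 : 1 ≤ x 0 := by simpa using h
    exact ⟨fun i => if i = 0 then 1 else 0, fun i => by dsimp only; split_ifs with hi <;> simp [hi, h0], by simp⟩
  | succ m ih =>
    by_cases hA : 2 ^ m ≤ ∑ i ∈ Finset.range (m + 1), x i * 2 ^ (m - i)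
    · obtain ⟨y, hy, hs⟩ := ih hA
      refine ⟨fun i => if i = m + 1 then 0 else y i, fun i => ?_, ?_⟩
      · dsimp only
        split_ifs
        · exact Nat.zero_le _
        · exact hy i
      · beta_reduce
        rw [Finset.sum_range_succ, if_pos rfl, zero_mul, add_zero]
        rw [Finset.sum_congr rfl (g := fun i => y i * 2 ^ (m + 1 - i)), dbl, hs, pow_succ]
        · ring
        · intro i hi
          have := Finset.mem_range.1 hi
          rw [if_neg (by omega)]
    · rw [Finset.sum_range_succ, dbl] at h
      rw [pow_succ] at h
      simp only [Nat.sub_self, pow_zero, mul_one] at h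
      -- The upper levels fall short, so all are kept; a leaf on the last level counts 1, so the
      -- deficit is met exactly.
      refine ⟨fun i => if i = m + 1 then
        2 * 2 ^ m - 2 * ∑ i ∈ Finset.range (m + 1), x i * 2 ^ (m - i) else x i, fun i => ?_, ?_⟩
      · dsimp only
        split_ifs with hi
        · subst hi
          omega
        · exact le_rfl
      · beta_reduce
        rw [Finset.sum_range_succ, if_pos rfl]
        rw [Finset.sum_congr rfl (g := fun i => x i * 2 ^ (m + 1 - i)), dbl, pow_succ]
        · simp only [Nat.sub_self, pow_zero, mul_one]
          omega
        · intro i hi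
          have := Finset.mem_range.1 hi
          rw [if_neg (by omega)]

namespace Constructible

variable {k d : ℕ} {x y z : ℕ → ℕ}

/-- The vector seen from the children has Kraft sum at least two. A part of sum exactly one goes to
one child; the rest, still at least one, goes to the other. -/
theorem of_kraft_aux (m : ℕ) (hm : m ≤ k) (x : ℕ → ℕ)
    (h : 2 ^ m ≤ ∑ i ∈ Finset.range (m + 1), x i * 2 ^ (m - i))
    (hx : ∑ i ∈ Finset.range (k + 1), x i ≤ d) : Constructible k d x := by
  induction m generalizing x with
  | zero => exact of_leaf (by simpa using h)
  | succ m ih =>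
    by_cases h0 : 1 ≤ x 0
    · exact of_leaf h0
    rw [Finset.sum_range_succ', show x 0 = 0 by omega, zero_mul, add_zero] at h
    simp only [Nat.add_sub_add_right] at h
    obtain ⟨y, hy, hs⟩ := exists_le_kraft_eq m (fun i => x (i + 1))
      (le_trans (Nat.pow_le_pow_right two_pos (Nat.le_succ m)) h)
    have bound : ∀ u : ℕ → ℕ, (∀ i, u i ≤ x (i + 1)) →
        ∑ i ∈ Finset.range (k + 1), (if i ≤ m then u i else 0) ≤ d := by
      intro u hu
      refine le_trans ?_ hx
      rw [Finset.sum_range_succ, if_neg (by omega), add_zero, Finset.sum_range_succ']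
      refine le_trans (Finset.sum_le_sum fun i _ => ?_) (Nat.le_add_right _ _)
      split_ifs
      · exact hu i
      · exact Nat.zero_le _
    have trunc : ∀ u : ℕ → ℕ, ∑ i ∈ Finset.range (m + 1), (if i ≤ m then u i else 0) * 2 ^ (m - i) =
        ∑ i ∈ Finset.range (m + 1), u i * 2 ^ (m - i) := by
      intro u
      refine Finset.sum_congr rfl fun i hi => ?_
      have := Finset.mem_range.1 hi
      rw [if_pos (by omega)]
    have hz : ∑ i ∈ Finset.range (m + 1), (x (i + 1) - y i) * 2 ^ (m - i) +
        ∑ i ∈ Finset.range (m + 1), y i * 2 ^ (m - i) =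
        ∑ i ∈ Finset.range (m + 1), x (i + 1) * 2 ^ (m - i) := by
      rw [← Finset.sum_add_distrib]
      refine Finset.sum_congr rfl fun i _ => ?_
      rw [← add_mul, Nat.sub_add_cancel (hy i)]
    refine of_node (ih (by omega) (fun i => if i ≤ m then y i else 0) ?_ (bound y hy))
      (ih (by omega) (fun i => if i ≤ m then x (i + 1) - y i else 0) ?_
        (bound _ fun i => Nat.sub_le _ _)) ?_ hx
    · rw [trunc, hs]
    · rw [trunc]
      rw [hs] at hz
      rw [pow_succ] at h
      omega
    · intro i _
      have : y i ≤ x (i + 1) := hy i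
      split_ifs <;> omega

/-- Kraft's inequality: a vector whose Kraft sum is at least one and whose total is at most `d` is
constructible. -/
theorem of_kraft (h : 2 ^ k ≤ ∑ i ∈ Finset.range (k + 1), x i * 2 ^ (k - i))
    (hx : ∑ i ∈ Finset.range (k + 1), x i ≤ d) : Constructible k d x :=
  of_kraft_aux k le_rfl x h hx

/-- Distribute the leaf budget of a node among its `2 ^ r` descendants at distance `r`. -/
theorem of_cut (r : ℕ) (x : ℕ → ℕ) (y : ℕ → ℕ → ℕ) (hy : ∀ j < 2 ^ r, Constructible k d (y j))
    (htop : ∀ j i, k < i + r → y j i = 0)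
    (hxy : ∀ i, i + r ≤ k → ∑ j ∈ Finset.range (2 ^ r), y j i ≤ x (i + r))
    (hx : ∑ i ∈ Finset.range (k + 1), x i ≤ d) : Constructible k d x := by
  induction r generalizing x y with
  | zero => exact (hy 0 (by simp)).mono fun i hi => by simpa using hxy i (by omega)
  | succ r ih =>
    -- The budget of a child of the root is what its `2 ^ r` descendants need, moved down by `r`. No
    -- new leaves enter, so its total is dominated by that of `x`.
    have half : ∀ u : ℕ → ℕ → ℕ, (∀ j < 2 ^ r, Constructible k d (u j)) →
        (∀ j i, k < i + (r + 1) → u j i = 0) →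
        (∀ i, i + (r + 1) ≤ k → ∑ j ∈ Finset.range (2 ^ r), u j i ≤ x (i + (r + 1))) →
        Constructible k d (fun i => if i < r then 0 else
          if i < k then ∑ j ∈ Finset.range (2 ^ r), u j (i - r) else 0) := by
      intro u hu hutop hux
      refine ih _ u hu (fun j i hi => hutop j i (by omega)) (fun i hi => ?_) ?_
      · rw [if_neg (by omega), Nat.add_sub_cancel]
        split_ifs with hik
        · exact le_rfl
        · exact le_of_eq (Finset.sum_eq_zero fun j _ => hutop j i (by omega))
      · refine le_trans ?_ hx
        rw [Finset.sum_range_succ, if_neg (lt_irrefl k), ite_self, add_zero,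
          Finset.sum_range_succ']
        refine le_trans (Finset.sum_le_sum fun i hi => ?_) (Nat.le_add_right _ _)
        have := Finset.mem_range.1 hi
        split_ifs with h1
        · exact Nat.zero_le _
        · refine (hux (i - r) (by omega)).trans (le_of_eq ?_)
          congr 1
          omega
    have split : ∀ i, ∑ j ∈ Finset.range (2 ^ (r + 1)), y j i =
        ∑ j ∈ Finset.range (2 ^ r), y j i + ∑ j ∈ Finset.range (2 ^ r), y (2 ^ r + j) i := by
      intro i
      rw [pow_succ, mul_two, Finset.sum_range_add]
    have hpow : 2 ^ (r + 1) = 2 ^ r + 2 ^ r := by rw [pow_succ, mul_two]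
    refine of_node (half y (fun j hj => hy j (by omega)) htop fun i hi => ?_)
      (half (fun j => y (2 ^ r + j)) (fun j hj => hy _ (by omega)) (fun j => htop _)
        fun i hi => ?_) (fun i hi => ?_) hx
    · have := hxy i hi
      rw [split] at this
      omega
    · have := hxy i hi
      rw [split] at this
      omega
    · by_cases hr : i < r
      · simp [hr]
      · have := hxy (i - r) (by omega)
        rw [split, show i - r + (r + 1) = i + 1 by omega] at this
        simpa [hr, hi] using this

/-- The inherited entries total at most `d / 2` and the new one at depth `k` is `d / 2`, so halving
can be repeated indefinitely. -/
theorem sum_halve_one_le (hx : ∑ i ∈ Finset.range (k + 1), x i ≤ d) :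
    ∑ i ∈ Finset.range (k + 1), halve k d 1 x i ≤ d := by
  rw [Finset.sum_range_succ']  at hx
  have h1 : 2 * ∑ i ∈ Finset.range k, halve k d 1 x i ≤ ∑ i ∈ Finset.range k, x (i + 1) := by
    rw [Finset.mul_sum]
    refine Finset.sum_le_sum fun i hi => ?_
    have := Finset.mem_range.1 hi
    rw [halve, if_pos (by omega), pow_one]
    exact Nat.mul_div_le _ _
  have h2 : halve k d 1 x k = d / 2 := by
    rw [halve, if_neg (by omega), Nat.add_sub_cancel_left, pow_one]
  rw [Finset.sum_range_succ, h2]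
  omega

theorem of_halve_one (hx : ∑ i ∈ Finset.range (k + 1), x i ≤ d)
    (h : Constructible k d (halve k d 1 x)) : Constructible k d x := by
  refine of_node h h (fun i hi => ?_) hx
  rw [halve, if_pos (by omega), pow_one]
  omega

theorem halve_succ (t : ℕ) {i : ℕ} (hi : i ≤ k) :
    halve k d (t + 1) x i = halve k d t (halve k d 1 x) i := by
  rcases lt_trichotomy (i + t) k with h | h | h
  · rw [halve, if_pos (by omega), halve, if_pos (by omega), halve, if_pos (by omega),
      Nat.div_div_eq_div_mul, ← pow_add, add_comm 1 t, add_assoc]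
  · rw [halve, if_neg (by omega), halve, if_pos (by omega), halve, if_neg (by omega),
      Nat.div_div_eq_div_mul, ← pow_add]
    congr 2
    omega
  · rw [halve, if_neg (by omega), halve, if_neg (by omega)]

theorem sum_halve_le (t : ℕ) (hx : ∑ i ∈ Finset.range (k + 1), x i ≤ d) :
    ∑ i ∈ Finset.range (k + 1), halve k d t x i ≤ d := by
  induction t generalizing x with
  | zero =>
    refine le_trans (Finset.sum_le_sum fun i hi => ?_) hx
    have := Finset.mem_range.1 hi
    simp [halve, show i ≤ k by omega]
  | succ t ih =>
    refine le_trans (Finset.sum_le_sum fun i hi => ?_) (ih (sum_halve_one_le hx))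
    have := Finset.mem_range.1 hi
    exact (halve_succ t (by omega)).le

theorem of_halve (t : ℕ) (hx : ∑ i ∈ Finset.range (k + 1), x i ≤ d)
    (h : Constructible k d (halve k d t x)) : Constructible k d x := by
  induction t generalizing x with
  | zero => exact h.mono fun i hi => by simp [halve, hi]
  | succ t ih =>
    exact of_halve_one hx (ih (sum_halve_one_le hx) (h.mono fun i hi => (halve_succ t hi).le))

end Constructible

end KSCNF

/-! ### Block profiles and rounds of uneven splitting. -/

namespace KSCNF

/-- A vector `x` of leaf budgets carries the profile `H`: the top `L * ℓ` depths are cut into `L`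
blocks of length `ℓ`, counted from the top, and in block `c`, apart from its last `r` depths, the
budget at depth `i` is at least `2 ^ (i - e) * H c`. -/
def HasProfile (k e L ℓ r : ℕ) (H : ℕ → ℕ) (x : ℕ → ℕ) : Prop :=
  ∀ c < L, ∀ m, m + r < ℓ → ∀ i, i + c * ℓ + m = k → 2 ^ (i - e) * H c ≤ x i

/-- The vector with profile `h`, shifted down by `r`. -/
def profileVec (k e L ℓ r : ℕ) (h : ℕ → ℕ) (i : ℕ) : ℕ :=
  if i + r ≤ k ∧ (k - (i + r)) / ℓ < L ∧ (k - (i + r)) % ℓ + r < ℓ then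
    2 ^ (i - e) * h ((k - (i + r)) / ℓ) else 0

variable {k e L ℓ r d q s N Θ : ℕ} {H H' x : ℕ → ℕ}

theorem profileVec_eq {h : ℕ → ℕ} {c m i : ℕ} (hc : c < L) (hm : m + r < ℓ)
    (hi : i + r + c * ℓ + m = k) : profileVec k e L ℓ r h i = 2 ^ (i - e) * h c := by
  have h1 : k - (i + r) = m + ℓ * c := by rw [mul_comm ℓ]; omega
  have h2 : (m + ℓ * c) / ℓ = c := by
    rw [Nat.add_mul_div_left _ _ (by omega), Nat.div_eq_of_lt (by omega), zero_add]
  have h3 : (m + ℓ * c) % ℓ = m := by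
    rw [Nat.add_mul_mod_self_left, Nat.mod_eq_of_lt (by omega)]
  rw [profileVec, h1, h2, h3, if_pos ⟨by omega, hc, hm⟩]

/-- A vector with one heavy block satisfies Kraft's inequality. -/
theorem Constructible.of_block {a : ℕ} (ha : a ≤ k) (hea : e + ℓ ≤ a + r)
    (hΘ : 2 ^ e ≤ (ℓ - r) * Θ) (hb : ∀ m, m + r < ℓ → 2 ^ (a - m - e) * Θ ≤ x (a - m))
    (hx : ∑ i ∈ Finset.range (k + 1), x i ≤ d) : Constructible k d x := by
  refine of_kraft ?_ hx
  have hinj : Set.InjOn (fun m => a - m) (Finset.range (ℓ - r) : Set ℕ) := by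
    intro m hm n hn hmn
    have h1 := Finset.mem_range.1 (Finset.mem_coe.1 hm)
    have h2 := Finset.mem_range.1 (Finset.mem_coe.1 hn)
    dsimp only at hmn
    omega
  -- In these units each depth of the block contributes at least the same amount `2 ^ (k - e) * Θ`
  -- to the Kraft sum.
  calc 2 ^ k ≤ ∑ m ∈ Finset.range (ℓ - r), 2 ^ (k - e) * Θ := by
        rw [Finset.sum_const, Finset.card_range, smul_eq_mul, mul_left_comm]
        by_cases hr : ℓ - r = 0
        · rw [hr, zero_mul] at hΘ
          exact absurd hΘ (by simp)
        · calc 2 ^ k = 2 ^ (k - e) * 2 ^ e := by rw [← pow_add]; congr 1; omega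
            _ ≤ _ := Nat.mul_le_mul_left _ hΘ
    _ ≤ ∑ m ∈ Finset.range (ℓ - r), x (a - m) * 2 ^ (k - (a - m)) := by
        refine Finset.sum_le_sum fun m hm => ?_
        have h1 := Finset.mem_range.1 hm
        refine le_trans (le_of_eq ?_) (Nat.mul_le_mul_right _ (hb m (by omega)))
        rw [mul_right_comm, ← pow_add]
        congr 2
        omega
    _ = ∑ i ∈ (Finset.range (ℓ - r)).image (fun m => a - m), x i * 2 ^ (k - i) :=
        (Finset.sum_image (f := fun i => x i * 2 ^ (k - i)) hinj).symm
    _ ≤ _ := by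
        refine Finset.sum_le_sum_of_subset fun i hi => ?_
        obtain ⟨m, -, rfl⟩ := Finset.mem_image.1 hi
        rw [Finset.mem_range]
        omega

/-- One round of the construction: a node whose budget has profile `H` is cut into `2 ^ r`
descendants. Of these, `t` receive enough of the lowest block to be completed at once, while the
remaining ones share the other blocks and are halved until a fresh top block has appeared. -/
theorem Constructible.of_profile {t : ℕ} (hd : d = 2 ^ (k - s)) (he : e = s + 1 + q)
    (hk : e + L * ℓ ≤ k) (hΘ : 2 ^ e ≤ (ℓ - r) * Θ) (htN : t ≤ 2 ^ r) (hL : 1 ≤ L)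
    (ht : t * Θ ≤ 2 ^ r * H (L - 1))
    (hH : ∀ c, c + 1 < L → (2 ^ r - t) * H' (c + 1) ≤ 2 ^ r * H c) (hH0 : H' 0 = 2 ^ q)
    (hsurv : t < 2 ^ r → ∀ y, HasProfile k e L ℓ r H' y →
      ∑ i ∈ Finset.range (k + 1), y i ≤ d → Constructible k d y)
    (hprof : HasProfile k e L ℓ r H x) (hx : ∑ i ∈ Finset.range (k + 1), x i ≤ d) :
    Constructible k d x := by
  have hrl : r < ℓ := by
    by_contra hcon
    rw [show ℓ - r = 0 by omega, zero_mul] at hΘ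
    exact absurd hΘ (by simp)
  -- Finishing descendants use only the lowest block. Survivors get none of it, and their block `c`
  -- is to become block `c + 1`.
  set hterm : ℕ → ℕ := fun c => if c + 1 = L then Θ else 0 with hterm_def
  set hsv : ℕ → ℕ := fun c => if c + 1 < L then H' (c + 1) else 0 with hsv_def
  set h : ℕ → ℕ → ℕ := fun j => if j < t then hterm else hsv with h_def
  have hsum : ∀ c < L, ∑ j ∈ Finset.range (2 ^ r), h j c ≤ 2 ^ r * H c := by
    intro c hc
    have e1 : ∑ j ∈ Finset.range (2 ^ r), h j c = t * hterm c + (2 ^ r - t) * hsv c := by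
      conv_lhs => rw [show 2 ^ r = t + (2 ^ r - t) by omega, Finset.sum_range_add]
      congr 1
      · rw [Finset.sum_congr rfl (g := fun _ => hterm c), Finset.sum_const, Finset.card_range,
          smul_eq_mul]
        intro j hj
        simp [h_def, Finset.mem_range.1 hj]
      · rw [Finset.sum_congr rfl (g := fun _ => hsv c), Finset.sum_const, Finset.card_range,
          smul_eq_mul]
        intro j hj
        simp [h_def]
    rw [e1]
    by_cases hcL : c + 1 = L
    · simp only [hterm_def, hsv_def, hcL, if_true, lt_irrefl, if_false, mul_zero, add_zero]
      rwa [show c = L - 1 by omega]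
    · simp only [hterm_def, hsv_def, hcL, if_false, mul_zero, zero_add]
      rw [if_pos (by omega)]
      exact hH c (by omega)
  have hcut : ∀ i, i + r ≤ k →
      ∑ j ∈ Finset.range (2 ^ r), profileVec k e L ℓ r (h j) i ≤ x (i + r) := by
    intro i hi
    by_cases hcond : (k - (i + r)) / ℓ < L ∧ (k - (i + r)) % ℓ + r < ℓ
    · have hdm := Nat.div_add_mod (k - (i + r)) ℓ
      set c := (k - (i + r)) / ℓ with hc
      set m := (k - (i + r)) % ℓ with hm
      rw [mul_comm] at hdm
      have hi' : i + r + c * ℓ + m = k := by omega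
      have hcl : (c + 1) * ℓ ≤ L * ℓ := Nat.mul_le_mul_right _ hcond.1
      rw [add_mul, one_mul] at hcl
      rw [Finset.sum_congr rfl fun j _ => profileVec_eq hcond.1 hcond.2 hi', ← Finset.mul_sum]
      calc 2 ^ (i - e) * ∑ j ∈ Finset.range (2 ^ r), h j c
          ≤ 2 ^ (i - e) * (2 ^ r * H c) := Nat.mul_le_mul_left _ (hsum c hcond.1)
        _ = 2 ^ (i + r - e) * H c := by
          rw [← mul_assoc, ← pow_add]
          congr 2
          omega
        _ ≤ _ := hprof c hcond.1 m hcond.2 (i + r) hi'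
    · rw [Finset.sum_eq_zero]
      · exact Nat.zero_le _
      · intro j _
        rw [profileVec, if_neg fun hh => hcond hh.2]
  have htop : ∀ j i, k < i + r → profileVec k e L ℓ r (h j) i = 0 := by
    intro j i hi
    rw [profileVec, if_neg (by omega)]
  have hsumle : ∀ j < 2 ^ r, ∑ i ∈ Finset.range (k + 1), profileVec k e L ℓ r (h j) i ≤ d := by
    intro j hj
    refine le_trans ?_ hx
    have hrk : r ≤ k := by
      have := Nat.mul_le_mul_right ℓ hL
      omega
    calc ∑ i ∈ Finset.range (k + 1), profileVec k e L ℓ r (h j) i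
        = ∑ i ∈ Finset.range (k + 1 - r), profileVec k e L ℓ r (h j) i := by
          refine (Finset.sum_subset (Finset.range_mono (Nat.sub_le _ _)) fun i _ hi => ?_).symm
          rw [Finset.mem_range] at hi
          exact htop j i (by omega)
      _ ≤ ∑ i ∈ Finset.range (k + 1 - r), x (r + i) := by
          refine Finset.sum_le_sum fun i hi => ?_
          have := Finset.mem_range.1 hi
          rw [add_comm r]
          exact (Finset.single_le_sum (f := fun j => profileVec k e L ℓ r (h j) i)
            (fun _ _ => Nat.zero_le _) (Finset.mem_range.2 hj)).trans (hcut i (by omega))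
      _ ≤ ∑ i ∈ Finset.range (k + 1), x i := by
          conv_rhs => rw [show k + 1 = r + (k + 1 - r) by omega, Finset.sum_range_add]
          exact Nat.le_add_left _ _
  refine of_cut r x (fun j => profileVec k e L ℓ r (h j)) (fun j hj => ?_) htop hcut hx
  have hLl : (L - 1) * ℓ + ℓ = L * ℓ := by
    rw [← Nat.succ_mul]
    congr 1
    omega
  by_cases hjt : j < t
  · refine of_block (a := k - r - (L - 1) * ℓ) (by omega) (by omega) hΘ (fun m hm => ?_)
      (hsumle j hj)
    rw [profileVec_eq (c := L - 1) (m := m) (by omega) hm (by omega)]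
    simp [h_def, hjt, hterm_def, show L - 1 + 1 = L by omega]
  -- The cut already moved the budgets by `r`, so `ℓ - r` halvings complete a shift by one block.
  -- They create only `ℓ - r` new depths, hence the `r` depths left out of each block.
  · refine of_halve (ℓ - r) (hsumle j hj) (hsurv (by omega) _ ?_ (sum_halve_le _ (hsumle j hj)))
    rintro (_ | c) hc m hm i hi
    · have : ℓ ≤ L * ℓ := Nat.le_mul_of_pos_left _ hL
      -- A fresh entry is `2 ^ (i - s - 1)`, that is, weight `2 ^ q` since `e = s + 1 + q`.
      rw [halve, if_neg (by omega), hH0, hd, Nat.pow_div (by omega) two_pos, ← pow_add]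
      exact Nat.pow_le_pow_right two_pos (by omega)
    · rw [add_mul, one_mul] at hi
      have hcl : (c + 1 + 1) * ℓ ≤ L * ℓ := Nat.mul_le_mul_right _ hc
      simp only [add_mul, one_mul] at hcl
      rw [halve, if_pos (by omega), profileVec_eq (c := c) (m := m) (by omega) hm (by omega)]
      simp only [h_def, hjt, if_false, hsv_def, hc, if_true]
      rw [Nat.le_div_iff_mul_le (by positivity), mul_right_comm, ← pow_add]
      refine le_of_eq ?_
      congr 2
      omega

/-- The course of the rounds for three blocks, `2 ^ 8` descendants, `q = 6` and `Θ = 385`, started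
with weights `a`, `b`, `c` (from top to bottom): within `n` rounds every descendant is complete. -/
def Completes : ℕ → ℕ → ℕ → ℕ → Prop
  | 0, _, _, _ => False
  | n + 1, a, b, c => 385 ≤ c ∨
      Completes n 64 (256 * a / (256 - 256 * c / 385)) (256 * b / (256 - 256 * c / 385))

/-- The profile with weights `a`, `b`, `c` from top to bottom. -/
def triple (a b c : ℕ) : ℕ → ℕ
  | 0 => a
  | 1 => b
  | _ => c

theorem Constructible.of_completes (n a b c : ℕ) (hn : Completes n a b c)
    (hd : d = 2 ^ (k - s)) (he : e = s + 1 + 6) (hk : e + 3 * ℓ ≤ k)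
    (hΘ : 2 ^ e ≤ (ℓ - 8) * 385) (hprof : HasProfile k e 3 ℓ 8 (triple a b c) x)
    (hx : ∑ i ∈ Finset.range (k + 1), x i ≤ d) : Constructible k d x := by
  induction n generalizing a b c x with
  | zero => exact hn.elim
  | succ n ih =>
    by_cases hc : 385 ≤ c
    -- All descendants finish; with no survivors, `H'` is a dummy.
    · refine of_profile (t := 2 ^ 8) (H' := triple (2 ^ 6) 0 0) hd he hk hΘ le_rfl (by norm_num)
        (Nat.mul_le_mul_left _ hc) ?_ rfl (fun h => absurd h (lt_irrefl _)) hprof hx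
      simp
    -- This `t` is the number of descendants that the lowest block can supply with weight 385.
    · refine of_profile (t := 256 * c / 385) (H := triple a b c) (H' := triple 64
        (256 * a / (256 - 256 * c / 385)) (256 * b / (256 - 256 * c / 385))) hd he hk hΘ
        (by omega) (by norm_num) (Nat.div_mul_le_self _ _) ?_ rfl
        (fun _ y hy hys => ih _ _ _ (hn.resolve_left hc) hy hys) hprof hx
      intro i hi
      obtain rfl | rfl : i = 0 ∨ i = 1 := by omega
      · exact Nat.mul_div_le _ _
      · exact Nat.mul_div_le _ _

/-- Up to rounding, a stationary state would need `c * (1 - c / 385) ^ 2 = 64`, but the left side is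
at most about 57 for `c` between 0 and 385. Two blocks would not do: their threshold is just above
256, and `c * (1 - c / Θ)` reaches `Θ / 4 > 64`. -/
theorem completes_initial : Completes 16 64 64 64 := by
  norm_num [Completes]

/-- The vector that allows `2 ^ (k - s)` leaves at depth `k` and none above. -/
theorem constructible_single (h1 : s + 7 + 3 * ℓ ≤ k) (h2 : 2 ^ (s + 7) ≤ (ℓ - 8) * 385) :
    Constructible k (2 ^ (k - s)) (fun i => if i = k then 2 ^ (k - s) else 0) := by
  have hsum : ∑ i ∈ Finset.range (k + 1), (if i = k then 2 ^ (k - s) else 0) ≤ 2 ^ (k - s) := by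
    simp
  -- After `3 * ℓ` halvings all three blocks consist of fresh entries, of weight `2 ^ 6`.
  refine Constructible.of_halve (3 * ℓ) hsum (Constructible.of_completes 16 64 64 64
    completes_initial rfl rfl h1 h2 ?_ (Constructible.sum_halve_le _ hsum))
  intro c hc m hm i hi
  have hcl : (c + 1) * ℓ ≤ 3 * ℓ := Nat.mul_le_mul_right _ hc
  rw [add_mul, one_mul] at hcl
  have h64 : triple 64 64 64 c = 2 ^ 6 := by
    obtain rfl | rfl | rfl : c = 0 ∨ c = 1 ∨ c = 2 := by omega
    all_goals rfl
  rw [halve, if_neg (by omega), h64, Nat.pow_div (by omega) two_pos, ← pow_add]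
  exact Nat.pow_le_pow_right two_pos (by omega)

theorem constructible_single_of_le {s k : ℕ} (hs : 20 ≤ s) (h1 : 2 ^ s ≤ k) :
    Constructible k (2 ^ (k - s)) (fun i => if i = k then 2 ^ (k - s) else 0) := by
  -- As `385 = 3 * 128 + 1`, three blocks filling depth `k` have a surplus of order `k`, which must
  -- absorb the lost depths: `s + 7`, three times 8, and the rounding of `ℓ`.
  have h3 : 385 * (s + 33) ≤ 2 ^ s := by
    induction s, hs using Nat.le_induction with
    | base => norm_num
    | succ n _ ih =>
      rw [pow_succ] at h1 ⊢
      have := ih (by omega)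
      omega
  refine constructible_single (ℓ := (k - s - 7) / 3) (by omega) ?_
  rw [pow_add]
  omega

end KSCNF

/-! ### From bounded trees to formulas in MU(1). -/

namespace KSCNF

/-- No leaf has depth less than `k`. -/
def BTree.Deep (k : ℕ) (T : BTree) : Prop := ∀ i < k, T.leavesAt i = 0

/-- Both subtrees below every internal node have a leaf at depth less than `k`. -/
def BTree.Tight (k : ℕ) : BTree → Prop
  | .leaf => True
  | .node l r => (¬ l.Deep k ∧ l.Tight k) ∧ (¬ r.Deep k ∧ r.Tight k)

/-- A minimal deep subtree is tight, and subtrees inherit boundedness. -/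
theorem BTree.tight_or_exists {k d : ℕ} (hk : 1 ≤ k) (T : BTree) (hT : T.Bounded k d) :
    (¬ T.Deep k ∧ T.Tight k) ∨ ∃ U : BTree, U.Bounded k d ∧ U.Deep k ∧ U.Tight k := by
  induction T with
  | leaf => exact .inl ⟨fun h => absurd (h 0 hk) (by simp [leavesAt]), trivial⟩
  | node l r ihl ihr =>
    rcases ihl hT.2.1 with hl | hl
    · rcases ihr hT.2.2 with hr | hr
      · by_cases hD : (node l r).Deep k
        · exact .inr ⟨_, hT, hD, hl, hr⟩
        · exact .inl ⟨hD, hl, hr⟩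
      · exact .inr hr
    · exact .inr hl

/-- The addresses of the leaves of a tree whose root has address `p`; the last step comes first. -/
def BTree.leaves : BTree → List Bool → Finset (List Bool)
  | .leaf, p => {p}
  | .node l r, p => l.leaves (true :: p) ∪ r.leaves (false :: p)

/-- The addresses of the internal nodes of a tree whose root has address `p`. -/
def BTree.internals : BTree → List Bool → Finset (List Bool)
  | .leaf, _ => ∅
  | .node l r, p => insert p (l.internals (true :: p) ∪ r.internals (false :: p))

/-- The literals at the edges from the node with address `p` to the root. -/
def edgeLits : List Bool → List Literal
  | [] => []
  | b :: p => (Encodable.encode p, b) :: edgeLits p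

/-- The clause of the last `k` edges on the path to the node with address `p`. -/
def pathClause (k : ℕ) (p : List Bool) : Clause := ((edgeLits p).take k).toFinset

/-- The formula that consists of the clauses of all leaves of `T`. -/
def BTree.formula (k : ℕ) (T : BTree) : Formula := (T.leaves []).image (pathClause k)

variable {k d : ℕ}

/-- Ancestors are suffixes of addresses, so occurrence in a clause becomes a suffix relation with a
length bound. -/
theorem mem_take_edgeLits (p : List Bool) (l : Literal) : l ∈ (edgeLits p).take k ↔
    ∃ t, l.1 = Encodable.encode t ∧ (l.2 :: t) <:+ p ∧ p.length ≤ t.length + k := by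
  induction p generalizing k with
  | nil => simp [edgeLits]
  | cons b p ih =>
    cases k with
    | zero =>
      simp only [List.take_zero, List.not_mem_nil, false_iff, not_exists]
      rintro t ⟨-, h1, h2⟩
      have := h1.length_le
      simp only [List.length_cons] at this h2
      omega
    | succ k =>
      rw [edgeLits, List.take_succ_cons, List.mem_cons, ih]
      constructor
      · rintro (rfl | ⟨t, h1, h2, h3⟩)
        · exact ⟨p, rfl, List.suffix_rfl, by simp⟩
        · exact ⟨t, h1, h2.trans (List.suffix_cons b p), by simp; omega⟩
      · rintro ⟨t, h1, h2, h3⟩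
        rcases List.suffix_cons_iff.1 h2 with h | h
        · obtain ⟨h4, rfl⟩ := List.cons.inj h
          exact .inl (Prod.ext h1 h4)
        · exact .inr ⟨t, h1, h, by simp at h3; omega⟩

theorem mem_pathClause (p : List Bool) (l : Literal) : l ∈ pathClause k p ↔
    ∃ t, l.1 = Encodable.encode t ∧ (l.2 :: t) <:+ p ∧ p.length ≤ t.length + k := by
  rw [pathClause, List.mem_toFinset, mem_take_edgeLits]

theorem length_edgeLits (p : List Bool) : (edgeLits p).length = p.length := by
  induction p with
  | nil => rfl
  | cons b p ih => simp [edgeLits, ih]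

theorem nodup_edgeLits (p : List Bool) : (edgeLits p).Nodup := by
  induction p with
  | nil => exact List.nodup_nil
  | cons b p ih =>
    refine List.nodup_cons.2 ⟨fun h => ?_, ih⟩
    rw [← List.take_length (l := edgeLits p), mem_take_edgeLits] at h
    obtain ⟨t, h1, h2, -⟩ := h
    have h3 := h2.length_le
    rw [Encodable.encode_injective h1] at h3
    simp at h3

theorem card_pathClause {p : List Bool} (hp : k ≤ p.length) : (pathClause k p).card = k := by
  rw [pathClause, List.toFinset_card_of_nodup ((nodup_edgeLits p).take), List.length_take,
    length_edgeLits, min_eq_left hp]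

/-- For `1 ≤ k` the clause contains the last edge, which determines the whole address. -/
theorem suffix_of_pathClause_eq {p q : List Bool} (hk : 1 ≤ k)
    (h : pathClause k p = pathClause k q) : p <:+ q := by
  cases p with
  | nil => exact List.nil_suffix
  | cons b p =>
    have h1 : ((Encodable.encode p, b) : Literal) ∈ pathClause k (b :: p) :=
      (mem_pathClause _ _).2 ⟨p, rfl, List.suffix_rfl, by simp; omega⟩
    rw [h, mem_pathClause] at h1
    obtain ⟨t, h2, h3, -⟩ := h1
    rw [Encodable.encode_injective h2]
    exact h3

theorem pathClause_injective (hk : 1 ≤ k) : Function.Injective (pathClause k) := by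
  intro p q h
  have h1 := suffix_of_pathClause_eq hk h
  have h2 := suffix_of_pathClause_eq hk h.symm
  exact h1.eq_of_length (le_antisymm h1.length_le h2.length_le)

namespace BTree

theorem suffix_of_mem_leaves {T : BTree} {p q : List Bool} (h : q ∈ T.leaves p) : p <:+ q := by
  induction T generalizing p with
  | leaf => exact (Finset.mem_singleton.1 h) ▸ List.suffix_rfl
  | node l r ihl ihr =>
    rcases Finset.mem_union.1 h with h | h
    · exact (List.suffix_cons _ _).trans (ihl h)
    · exact (List.suffix_cons _ _).trans (ihr h)

theorem suffix_of_mem_internals {T : BTree} {p q : List Bool} (h : q ∈ T.internals p) :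
    p <:+ q := by
  induction T generalizing p with
  | leaf => simp [internals] at h
  | node l r ihl ihr =>
    rcases Finset.mem_insert.1 h with rfl | h
    · exact List.suffix_rfl
    rcases Finset.mem_union.1 h with h | h
    · exact (List.suffix_cons _ _).trans (ihl h)
    · exact (List.suffix_cons _ _).trans (ihr h)

theorem not_suffix_both {p q : List Bool} (h1 : (true :: p) <:+ q) (h2 : (false :: p) <:+ q) :
    False := by
  have := (List.suffix_of_suffix_length_le h1 h2 (by simp)).eq_of_length (by simp)
  simp at this

theorem disjoint_leaves (l r : BTree) (p : List Bool) :
    Disjoint (l.leaves (true :: p)) (r.leaves (false :: p)) :=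
  Finset.disjoint_left.2 fun _ h1 h2 =>
    not_suffix_both (suffix_of_mem_leaves h1) (suffix_of_mem_leaves h2)

theorem card_leaves (T : BTree) (p : List Bool) :
    (T.leaves p).card = (T.internals p).card + 1 := by
  induction T generalizing p with
  | leaf => simp [leaves, internals]
  | node l r ihl ihr =>
    rw [leaves, internals, Finset.card_union_of_disjoint (disjoint_leaves l r p), ihl, ihr,
      Finset.card_insert_of_notMem, Finset.card_union_of_disjoint]
    · omega
    · exact Finset.disjoint_left.2 fun _ h1 h2 =>
        not_suffix_both (suffix_of_mem_internals h1) (suffix_of_mem_internals h2)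
    · intro h
      rcases Finset.mem_union.1 h with h | h <;>
      · have := (suffix_of_mem_internals h).length_le
        simp at this

theorem card_leaves_length_eq (T : BTree) (p : List Bool) (i : ℕ) :
    ((T.leaves p).filter fun q => q.length = p.length + i).card = T.leavesAt i := by
  induction T generalizing p i with
  | leaf => cases i <;> simp [leaves, leavesAt, Finset.filter_singleton]
  | node l r ihl ihr =>
    cases i with
    | zero =>
      rw [leavesAt, Finset.card_eq_zero, Finset.filter_eq_empty_iff]
      intro q hq hlen
      rcases Finset.mem_union.1 hq with h | h <;>
      · have := (suffix_of_mem_leaves h).length_le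
        simp at this
        omega
    | succ i =>
      rw [leaves, Finset.filter_union, Finset.card_union_of_disjoint
        (Finset.disjoint_filter_filter (disjoint_leaves l r p)), leavesAt,
        ← ihl (true :: p), ← ihr (false :: p)]
      simp only [List.length_cons, add_assoc, add_comm 1 i]

theorem card_leaves_length_le (T : BTree) (p : List Bool) (k : ℕ) :
    ((T.leaves p).filter fun q => q.length ≤ p.length + k).card =
      ∑ i ∈ Finset.range (k + 1), T.leavesAt i := by
  rw [Finset.card_eq_sum_card_fiberwise (f := fun q => q.length - p.length)
    (t := Finset.range (k + 1))]
  · refine Finset.sum_congr rfl fun i hi => ?_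
    rw [← card_leaves_length_eq T p i, Finset.filter_filter]
    congr 1
    refine Finset.filter_congr fun q hq => ?_
    have h1 := (suffix_of_mem_leaves hq).length_le
    have h2 := Finset.mem_range.1 hi
    omega
  · intro q hq
    have h1 := (Finset.mem_filter.1 (Finset.mem_coe.1 hq)).2
    rw [Finset.coe_range, Set.mem_Iio]
    dsimp only
    omega

theorem exists_leaf_of_not_deep {T : BTree} (h : ¬ T.Deep k) (p : List Bool) :
    ∃ q ∈ T.leaves p, q.length < p.length + k := by
  simp only [Deep, not_forall] at h
  obtain ⟨i, hi, h0⟩ := h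
  rw [← card_leaves_length_eq T p, ← ne_eq, Finset.card_ne_zero] at h0
  obtain ⟨q, hq⟩ := h0
  rw [Finset.mem_filter] at hq
  exact ⟨q, hq.1, by omega⟩

/-- At most `d` leaves lie strictly below a given node within distance `k`. -/
theorem card_leaves_below_le {T : BTree} (hT : T.Bounded k d) (p t : List Bool) (hpt : p <:+ t) :
    ((T.leaves p).filter fun q => (t <:+ q ∧ t ≠ q) ∧ q.length ≤ t.length + k).card ≤ d := by
  induction T generalizing p with
  | leaf =>
    refine le_trans (le_of_eq ?_) (Nat.zero_le d)
    rw [Finset.card_eq_zero, Finset.filter_eq_empty_iff]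
    rintro q hq ⟨⟨h1, h2⟩, -⟩
    obtain rfl := Finset.mem_singleton.1 hq
    exact h2 (h1.eq_of_length (le_antisymm h1.length_le hpt.length_le))
  | node l r ihl ihr =>
    by_cases htp : t = p
    · subst htp
      refine le_trans (Finset.card_le_card fun q hq => ?_)
        ((card_leaves_length_le (node l r) t k).le.trans hT.1)
      rw [Finset.mem_filter] at hq ⊢
      exact ⟨hq.1, hq.2.2⟩
    · obtain ⟨u, rfl⟩ := hpt
      obtain ⟨u, b, rfl⟩ : ∃ v b, u = v ++ [b] := by
        refine ⟨u.dropLast, u.getLast ?_, (List.dropLast_append_getLast _).symm⟩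
        rintro rfl
        exact htp rfl
      rw [List.append_assoc, List.singleton_append] at *
      have hsuf : (b :: p) <:+ (u ++ b :: p) := List.suffix_append _ _
      cases b with
      | true =>
        refine le_trans (Finset.card_le_card fun q hq => ?_) (ihl hT.2.1 (true :: p) hsuf)
        rw [Finset.mem_filter] at hq ⊢
        refine ⟨(Finset.mem_union.1 hq.1).resolve_right fun h => ?_, hq.2⟩
        exact not_suffix_both (hsuf.trans hq.2.1.1) (suffix_of_mem_leaves h)
      | false =>
        refine le_trans (Finset.card_le_card fun q hq => ?_) (ihr hT.2.2 (false :: p) hsuf)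
        rw [Finset.mem_filter] at hq ⊢
        refine ⟨(Finset.mem_union.1 hq.1).resolve_left fun h => ?_, hq.2⟩
        exact not_suffix_both (suffix_of_mem_leaves h) (hsuf.trans hq.2.1.1)

/-- Every assignment of truth values to the nodes leads to a leaf. -/
theorem exists_leaf_falsified (T : BTree) (p : List Bool) (σ : List Bool → Bool) :
    ∃ q ∈ T.leaves p, ∀ b t, (b :: t) <:+ q → p <:+ t → σ t ≠ b := by
  induction T generalizing p with
  | leaf =>
    refine ⟨p, Finset.mem_singleton_self p, fun b t h1 h2 => ?_⟩
    have := h1.length_le.trans h2.length_le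
    simp at this
  | node l r ihl ihr =>
    have key : ∀ (c : Bool) (q : List Bool), (c :: p) <:+ q → σ p = !c →
        (∀ b t, (b :: t) <:+ q → (c :: p) <:+ t → σ t ≠ b) →
        ∀ b t, (b :: t) <:+ q → p <:+ t → σ t ≠ b := by
      intro c q hcq hσ hq b t h1 h2
      by_cases hlen : t.length = p.length
      · obtain rfl := h2.eq_of_length hlen.symm
        have := (List.suffix_of_suffix_length_le h1 hcq (by simp)).eq_of_length (by simp)
        obtain rfl : b = c := (List.cons.inj this).1
        rw [hσ]
        cases b <;> simp
      · refine hq b t h1 (List.suffix_of_suffix_length_le hcq ((List.suffix_cons b t).trans h1) ?_)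
        have := h2.length_le
        simp only [List.length_cons]
        omega
    cases hσ : σ p with
    | false =>
      obtain ⟨q, hq, h⟩ := ihl (true :: p)
      exact ⟨q, Finset.mem_union_left _ hq, key true q (suffix_of_mem_leaves hq) hσ h⟩
    | true =>
      obtain ⟨q, hq, h⟩ := ihr (false :: p)
      exact ⟨q, Finset.mem_union_right _ hq, key false q (suffix_of_mem_leaves hq) hσ h⟩

/-- In a tight tree some assignment satisfies the clauses of all leaves but a given one. -/
theorem exists_satisfying_except {T : BTree} (hT : T.Tight k) (p v : List Bool)
    (hv : v ∈ T.leaves p) : ∃ σ : List Bool → Bool, ∀ q ∈ T.leaves p, q ≠ v →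
      ∃ t, p <:+ t ∧ (σ t :: t) <:+ q ∧ q.length ≤ t.length + k := by
  induction T generalizing p v with
  | leaf =>
    refine ⟨fun _ => true, fun q hq hqv => absurd ?_ hqv⟩
    rw [Finset.mem_singleton.1 hq, Finset.mem_singleton.1 hv]
  | node l r ihl ihr =>
    have merge : ∀ (c : Bool) (A B : Finset (List Bool)) (σ₁ σ₂ : List Bool → Bool)
        (w : List Bool), ((!c) :: p) <:+ w → w.length < ((!c) :: p).length + k →
        (∀ q ∈ A, q ≠ v → ∃ t, (c :: p) <:+ t ∧ (σ₁ t :: t) <:+ q ∧ q.length ≤ t.length + k) →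
        (∀ q ∈ B, q ≠ w → ∃ t, ((!c) :: p) <:+ t ∧ (σ₂ t :: t) <:+ q ∧
          q.length ≤ t.length + k) →
        ∃ σ : List Bool → Bool, ∀ q ∈ A ∪ B, q ≠ v →
          ∃ t, p <:+ t ∧ (σ t :: t) <:+ q ∧ q.length ≤ t.length + k := by
      intro c A B σ₁ σ₂ w hw hwl h1 h2
      classical
      -- Here `v` is on side `c` and `w` is a leaf close to `p` on the other side. The clause of `w`
      -- still contains the edge at `p`, so the value `!c` at `p` satisfies it.
      refine ⟨fun t => if (c :: p) <:+ t then σ₁ t else if ((!c) :: p) <:+ t then σ₂ t else !c,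
        fun q hq hqv => ?_⟩
      by_cases hqA : q ∈ A
      · obtain ⟨t, ha, hb, hc⟩ := h1 q hqA hqv
        exact ⟨t, (List.suffix_cons _ _).trans ha, by simpa only [if_pos ha] using hb, hc⟩
      · by_cases hqw : q = w
        · subst hqw
          refine ⟨p, List.suffix_rfl, ?_, ?_⟩
          · beta_reduce
            rw [if_neg, if_neg]
            · exact hw
            · intro h
              have := h.length_le
              simp at this
            · intro h
              have := h.length_le
              simp at this
          · simp only [List.length_cons] at hwl
            omega
        · obtain ⟨t, ha, hb, hc⟩ := h2 q ((Finset.mem_union.1 hq).resolve_left hqA) hqw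
          refine ⟨t, (List.suffix_cons _ _).trans ha, ?_, hc⟩
          beta_reduce
          rw [if_neg, if_pos ha]
          · exact hb
          · intro h
            cases c
            · exact not_suffix_both ha h
            · exact not_suffix_both h ha
    rcases Finset.mem_union.1 hv with hv | hv
    · obtain ⟨w, hw, hwl⟩ := exists_leaf_of_not_deep hT.2.1 (false :: p)
      obtain ⟨σ₁, h1⟩ := ihl hT.1.2 _ v hv
      obtain ⟨σ₂, h2⟩ := ihr hT.2.2 _ w hw
      exact merge true _ _ σ₁ σ₂ w (suffix_of_mem_leaves hw) hwl h1 h2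
    · obtain ⟨w, hw, hwl⟩ := exists_leaf_of_not_deep hT.1.1 (true :: p)
      obtain ⟨σ₁, h1⟩ := ihr hT.2.2 _ v hv
      obtain ⟨σ₂, h2⟩ := ihl hT.1.2 _ w hw
      rw [leaves, Finset.union_comm]
      exact merge false _ _ σ₁ σ₂ w (suffix_of_mem_leaves hw) hwl h1 h2

theorem mem_internals_of_suffix {T : BTree} {p q t : List Bool} (hq : q ∈ T.leaves p)
    (hpt : p <:+ t) (htq : t <:+ q) (hne : t ≠ q) : t ∈ T.internals p := by
  induction T generalizing p with
  | leaf =>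
    obtain rfl := Finset.mem_singleton.1 hq
    exact absurd (htq.eq_of_length (le_antisymm htq.length_le hpt.length_le)) hne
  | node l r ihl ihr =>
    by_cases hlen : t.length = p.length
    · rw [hpt.eq_of_length hlen.symm]
      exact Finset.mem_insert_self _ _
    · have key : ∀ b : Bool, (b :: p) <:+ q → (b :: p) <:+ t := by
        intro b hb
        refine List.suffix_of_suffix_length_le hb htq ?_
        have := hpt.length_le
        simp only [List.length_cons]
        omega
      refine Finset.mem_insert_of_mem ?_
      rcases Finset.mem_union.1 hq with h | h
      · exact Finset.mem_union_left _ (ihl h (key _ (suffix_of_mem_leaves h)))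
      · exact Finset.mem_union_right _ (ihr h (key _ (suffix_of_mem_leaves h)))

/-- This makes the variable of every internal node occur in the formula, as the variable count in
MU(1) requires. -/
theorem exists_leaf_below {T : BTree} (hT : T.Tight k) {p t : List Bool} (ht : t ∈ T.internals p) :
    ∃ q ∈ T.leaves p, (true :: t) <:+ q ∧ q.length ≤ t.length + k := by
  induction T generalizing p with
  | leaf => simp [internals] at ht
  | node l r ihl ihr =>
    rcases Finset.mem_insert.1 ht with rfl | ht
    · obtain ⟨w, hw, hwl⟩ := exists_leaf_of_not_deep hT.1.1 (true :: t)
      refine ⟨w, Finset.mem_union_left _ hw, suffix_of_mem_leaves hw, ?_⟩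
      simp only [List.length_cons] at hwl
      omega
    rcases Finset.mem_union.1 ht with ht | ht
    · obtain ⟨q, hq, h⟩ := ihl hT.1.2 ht
      exact ⟨q, Finset.mem_union_left _ hq, h⟩
    · obtain ⟨q, hq, h⟩ := ihr hT.2.2 ht
      exact ⟨q, Finset.mem_union_right _ hq, h⟩

theorem length_of_deep {T : BTree} (hT : T.Deep k) {q : List Bool} (hq : q ∈ T.leaves []) :
    k ≤ q.length := by
  by_contra! h
  have h1 := hT q.length h
  rw [← card_leaves_length_eq T [], Finset.card_eq_zero, Finset.filter_eq_empty_iff] at h1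
  exact h1 hq (by simp)

theorem mem_vars_pathClause {x : ℕ} {q : List Bool} : x ∈ Clause.vars (pathClause k q) ↔
    ∃ t, x = Encodable.encode t ∧ (t <:+ q ∧ t ≠ q) ∧ q.length ≤ t.length + k := by
  rw [Clause.vars, Finset.mem_image]
  constructor
  · rintro ⟨l, hl, rfl⟩
    obtain ⟨t, h1, h2, h3⟩ := (mem_pathClause _ _).1 hl
    refine ⟨t, h1, ⟨(List.suffix_cons _ _).trans h2, ?_⟩, h3⟩
    rintro rfl
    simpa using h2.length_le
  · rintro ⟨t, rfl, ⟨⟨u, rfl⟩, h2⟩, h3⟩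
    obtain ⟨u, b, rfl⟩ : ∃ v b, u = v ++ [b] := by
      refine ⟨u.dropLast, u.getLast ?_, (List.dropLast_append_getLast _).symm⟩
      rintro rfl
      exact h2 rfl
    refine ⟨(Encodable.encode t, b), (mem_pathClause _ _).2 ⟨t, rfl, ?_, h3⟩, rfl⟩
    rw [List.append_assoc, List.singleton_append]
    exact List.suffix_append _ _

theorem isKS_formula {T : BTree} (hb : T.Bounded k d) (hd : T.Deep k) :
    (T.formula k).IsKS k d := by
  refine ⟨fun C hC => ?_, fun x => ?_⟩
  · obtain ⟨q, hq, rfl⟩ := Finset.mem_image.1 hC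
    exact card_pathClause (length_of_deep hd hq)
  · rw [Formula.occ, formula, Finset.filter_image]
    refine Finset.card_image_le.trans ?_
    by_cases hx : ∃ t : List Bool, x = Encodable.encode t
    · obtain ⟨t, rfl⟩ := hx
      refine le_trans (Finset.card_le_card fun q hq => ?_)
        (card_leaves_below_le hb [] t List.nil_suffix)
      rw [Finset.mem_filter] at hq ⊢
      obtain ⟨t', h1, h2⟩ := mem_vars_pathClause.1 hq.2
      rw [Encodable.encode_injective h1]
      exact ⟨hq.1, h2⟩
    · refine le_trans (le_of_eq ?_) (Nat.zero_le d)
      rw [Finset.card_eq_zero, Finset.filter_eq_empty_iff]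
      intro q _ h
      obtain ⟨t, ht, -⟩ := mem_vars_pathClause.1 h
      exact hx ⟨t, ht⟩

theorem vars_formula {T : BTree} (ht : T.Tight k) :
    Formula.vars (T.formula k) = (T.internals []).image Encodable.encode := by
  ext x
  rw [Formula.vars, Finset.mem_biUnion, Finset.mem_image]
  constructor
  · rintro ⟨C, hC, hx⟩
    obtain ⟨q, hq, rfl⟩ := Finset.mem_image.1 hC
    obtain ⟨t, rfl, ⟨h1, h2⟩, -⟩ := mem_vars_pathClause.1 hx
    exact ⟨t, mem_internals_of_suffix hq List.nil_suffix h1 h2, rfl⟩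
  · rintro ⟨t, h, rfl⟩
    obtain ⟨q, hq, h1, h2⟩ := exists_leaf_below ht h
    refine ⟨_, Finset.mem_image_of_mem _ hq, mem_vars_pathClause.2
      ⟨t, rfl, ⟨(List.suffix_cons _ _).trans h1, ?_⟩, h2⟩⟩
    rintro rfl
    simpa using h1.length_le

theorem not_satisfiable_formula (T : BTree) : ¬ (T.formula k).Satisfiable := by
  rintro ⟨τ, hτ⟩
  obtain ⟨q, hq, h⟩ := exists_leaf_falsified T [] fun t => τ (Encodable.encode t)
  obtain ⟨l, hl, hs⟩ := hτ _ (Finset.mem_image_of_mem _ hq)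
  obtain ⟨t, h1, h2, -⟩ := (mem_pathClause _ _).1 hl
  exact h l.2 t h2 List.nil_suffix (by rw [← h1, hs])

/-- Clauses correspond to leaves and variables to internal nodes, whose numbers differ by one.
Deleting the clause of `v` leaves a formula satisfied by the assignment of
`exists_satisfying_except`. -/
theorem mu1_formula {T : BTree} (hk : 1 ≤ k) (ht : T.Tight k) : (T.formula k).MU1 := by
  refine ⟨⟨not_satisfiable_formula T, fun G hG => ?_⟩, ?_⟩
  · obtain ⟨C, hC, hCG⟩ := Finset.exists_of_ssubset hG
    obtain ⟨v, hv, rfl⟩ := Finset.mem_image.1 hC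
    obtain ⟨σ, hσ⟩ := exists_satisfying_except ht [] v hv
    refine ⟨fun x => ((Encodable.decode x : Option (List Bool)).map σ).getD true, fun D hD => ?_⟩
    obtain ⟨q, hq, rfl⟩ := Finset.mem_image.1 (hG.1 hD)
    obtain ⟨t, -, h1, h2⟩ := hσ q hq (by rintro rfl; exact hCG hD)
    exact ⟨(Encodable.encode t, σ t), (mem_pathClause _ _).2 ⟨t, rfl, h1, h2⟩, by simp⟩
  · rw [vars_formula ht, Finset.card_image_of_injective _ Encodable.encode_injective, formula,
      Finset.card_image_of_injective _ (pathClause_injective hk), card_leaves]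

end BTree

/-- If `d` leaves at depth `k` and none above are a constructible budget, then there is a
`(k, d)`-CNF formula in MU(1). -/
theorem Constructible.exists_mu1 {x : ℕ → ℕ} (hk : 1 ≤ k) (h : Constructible k d x)
    (hx : ∀ i < k, x i = 0) : ∃ F : Formula, F.IsKS k d ∧ F.MU1 := by
  obtain ⟨T, hT, hTx⟩ := h
  have hD : T.Deep k := fun i hi => Nat.eq_zero_of_le_zero ((hTx i hi.le).trans (hx i hi).le)
  obtain ⟨U, hb, hd, ht⟩ := (T.tight_or_exists hk hT).resolve_left fun h => h.1 hD
  exact ⟨U.formula k, BTree.isKS_formula hb hd, BTree.mu1_formula hk ht⟩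

end KSCNF

/-! ### The lower bound: counting partial assignments. -/

namespace KSCNF

/-- The assignment `A` (the set of true variables) satisfies the literal `l`. -/
def SatLit (A : Finset ℕ) (l : Literal) : Prop := l.1 ∈ A ↔ l.2 = true

open Classical in
/-- The assignments to the variables in `V` that satisfy every clause of `F` whose variables all
lie in `V`. -/
noncomputable def satSets (F : Formula) (V : Finset ℕ) : Finset (Finset ℕ) :=
  V.powerset.filter fun A => ∀ C ∈ F, Clause.vars C ⊆ V → ∃ l ∈ C, SatLit A l

theorem mem_satSets {F : Formula} {V A : Finset ℕ} : A ∈ satSets F V ↔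
    A ⊆ V ∧ ∀ C ∈ F, Clause.vars C ⊆ V → ∃ l ∈ C, SatLit A l := by
  classical
  rw [satSets, Finset.mem_filter, Finset.mem_powerset]

theorem mem_vars_of_mem {C : Clause} {l : Literal} (hl : l ∈ C) : l.1 ∈ Clause.vars C :=
  Finset.mem_image_of_mem _ hl

/-- Only a clause without complementary literals can be falsified. -/
theorem card_vars_of_falsified {C : Clause} {A : Finset ℕ} (h : ∀ l ∈ C, ¬ SatLit A l) :
    (Clause.vars C).card = C.card := by
  refine Finset.card_image_of_injOn fun l hl l' hl' hll => ?_
  have h1 := h l hl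
  have h2 := h l' hl'
  simp only [SatLit] at h1 h2
  rw [← hll] at h2
  refine Prod.ext hll ?_
  cases hb : l.2 <;> cases hb' : l'.2 <;> simp_all

open Classical in
/-- The assignments to `V` and `x` that are good on `V` and falsify a clause containing `x` are
determined by their restriction to the variables outside that clause. -/
theorem card_falsifying_le (F : Formula) {V : Finset ℕ} {x : ℕ} {C : Clause}
    (hx : x ∈ Clause.vars C) :
    ((insert x V).powerset.filter fun A => A.erase x ∈ satSets F V ∧ ∀ l ∈ C, ¬ SatLit A l).card ≤
      (satSets F (V \ Clause.vars C)).card := by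
  refine Finset.card_le_card_of_injOn (fun A => A \ Clause.vars C) ?_ ?_
  · intro A hA
    obtain ⟨hAV, hgood, -⟩ := Finset.mem_filter.1 (Finset.mem_coe.1 hA)
    rw [Finset.mem_powerset] at hAV
    rw [Finset.mem_coe, mem_satSets]
    refine ⟨fun v hv => ?_, fun D hD hDV => ?_⟩
    · rw [Finset.mem_sdiff] at hv ⊢
      refine ⟨(Finset.mem_insert.1 (hAV hv.1)).resolve_left ?_, hv.2⟩
      rintro rfl
      exact hv.2 hx
    · obtain ⟨l, hl, hs⟩ := (mem_satSets.1 hgood).2 D hD (hDV.trans Finset.sdiff_subset)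
      refine ⟨l, hl, ?_⟩
      have h1 := (Finset.mem_sdiff.1 (hDV (mem_vars_of_mem hl))).2
      have h2 : l.1 ≠ x := fun h => h1 (h ▸ hx)
      simpa [SatLit, h1, h2] using hs
  · intro A hA B hB hAB
    have hA' := (Finset.mem_filter.1 (Finset.mem_coe.1 hA)).2.2
    have hB' := (Finset.mem_filter.1 (Finset.mem_coe.1 hB)).2.2
    ext v
    by_cases hv : v ∈ Clause.vars C
    · obtain ⟨l, hl, rfl⟩ := Finset.mem_image.1 hv
      have h1 := hA' l hl
      have h2 := hB' l hl
      simp only [SatLit] at h1 h2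
      tauto
    · have := Finset.ext_iff.1 hAB v
      simpa [hv] using this

open Classical in
theorem card_extensions (F : Formula) {V : Finset ℕ} {x : ℕ} (hx : x ∉ V) :
    2 * (satSets F V).card =
      ((insert x V).powerset.filter fun A => A.erase x ∈ satSets F V).card := by
  have hnot : ∀ A ∈ satSets F V, x ∉ A := fun A hA h => hx ((mem_satSets.1 hA).1 h)
  have heq : (insert x V).powerset.filter (fun A => A.erase x ∈ satSets F V) =
      satSets F V ∪ (satSets F V).image (insert x) := by
    ext A
    rw [Finset.mem_filter, Finset.mem_powerset, Finset.mem_union, Finset.mem_image]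
    constructor
    · rintro ⟨-, h⟩
      by_cases hxA : x ∈ A
      · exact .inr ⟨_, h, Finset.insert_erase hxA⟩
      · rw [Finset.erase_eq_of_notMem hxA] at h
        exact .inl h
    · rintro (h | ⟨B, h, rfl⟩)
      · rw [Finset.erase_eq_of_notMem (hnot A h)]
        exact ⟨(mem_satSets.1 h).1.trans (Finset.subset_insert _ _), h⟩
      · rw [Finset.erase_insert (hnot B h)]
        exact ⟨Finset.insert_subset_insert _ (mem_satSets.1 h).1, h⟩
  rw [heq, Finset.card_union_of_disjoint, Finset.card_image_of_injOn, two_mul]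
  · intro A hA B hB hAB
    have := congrArg (Finset.erase · x) hAB
    simpa [Finset.erase_insert (hnot A hA), Finset.erase_insert (hnot B hB)] using this
  · refine Finset.disjoint_left.2 fun A hA hA' => ?_
    obtain ⟨B, -, rfl⟩ := Finset.mem_image.1 hA'
    exact hnot _ hA (Finset.mem_insert_self _ _)

/-- Rosenfeld's counting argument: every further variable multiplies the number of good
assignments by at least `β`. -/
theorem mul_card_satSets_le {k s : ℕ} {F : Formula} (hF : F.IsKS k s) {β : ℝ} (hβ : 0 < β)
    (hs : (s : ℝ) ≤ (2 - β) * β ^ (k - 1)) (V : Finset ℕ) (x : ℕ) (hx : x ∉ V) :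
    β * (satSets F V).card ≤ (satSets F (insert x V)).card := by
  classical
  induction hn : V.card using Nat.strong_induction_on generalizing V x with
  | _ n ih =>
    subst hn
    -- The induction hypothesis is iterated over the variables of `W`; it applies since only sets
    -- smaller than `V` are extended.
    have grow : ∀ U W : Finset ℕ, Disjoint U W → U ∪ W ⊆ V →
        β ^ W.card * (satSets F U).card ≤ (satSets F (U ∪ W)).card := by
      intro U W
      induction W using Finset.induction_on with
      | empty => intro _ _; simp
      | insert w W hw ihW =>
        intro hd hsub
        rw [Finset.disjoint_insert_right] at hd
        rw [Finset.union_insert] at hsub ⊢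
        have hw' : w ∉ U ∪ W := by simp [hw, hd.1]
        have h1 := ihW hd.2 ((Finset.subset_insert _ _).trans hsub)
        have hlt : (U ∪ W).card < V.card := by
          have := Finset.card_le_card hsub
          rw [Finset.card_insert_of_notMem hw'] at this
          omega
        rw [Finset.card_insert_of_notMem hw, pow_succ']
        calc β * β ^ W.card * (satSets F U).card = β * (β ^ W.card * (satSets F U).card) := by ring
          _ ≤ β * (satSets F (U ∪ W)).card := mul_le_mul_of_nonneg_left h1 hβ.le
          _ ≤ _ := ih _ hlt _ w hw' rfl
    set bad : Clause → Finset (Finset ℕ) := fun C =>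
      (insert x V).powerset.filter fun A => A.erase x ∈ satSets F V ∧ ∀ l ∈ C, ¬ SatLit A l
    set T := (F.filter fun C => x ∈ Clause.vars C).filter fun C => Clause.vars C ⊆ insert x V
    have hcover : ((insert x V).powerset.filter fun A => A.erase x ∈ satSets F V) ⊆
        satSets F (insert x V) ∪ T.biUnion bad := by
      intro A hA
      rw [Finset.mem_filter, Finset.mem_powerset] at hA
      rw [Finset.mem_union, Finset.mem_biUnion]
      by_contra! hcon
      refine hcon.1 (mem_satSets.2 ⟨hA.1, fun C hC hCV => ?_⟩)
      by_contra! hl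
      by_cases hxC : x ∈ Clause.vars C
      · exact hcon.2 C (by simp [T, hC, hxC, hCV]) 
          (Finset.mem_filter.2 ⟨Finset.mem_powerset.2 hA.1, hA.2, hl⟩)
      · have hCV' : Clause.vars C ⊆ V := by
          intro v hv
          refine (Finset.mem_insert.1 (hCV hv)).resolve_left ?_
          rintro rfl
          exact hxC hv
        obtain ⟨l, hlC, hs⟩ := (mem_satSets.1 hA.2).2 C hC hCV'
        refine hl l hlC ?_
        have : l.1 ≠ x := fun h => hxC (h ▸ mem_vars_of_mem hlC)
        simpa [SatLit, this] using hs
    have hbad : ∀ C ∈ T, ((bad C).card : ℝ) * β ^ (k - 1) ≤ (satSets F V).card := by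
      intro C hC
      simp only [T, Finset.mem_filter] at hC
      obtain ⟨⟨hCF, hxC⟩, hCV⟩ := hC
      -- A clause with complementary literals is never falsified; any other has exactly `k`
      -- variables, `k - 1` of them in `V`.
      rcases (bad C).eq_empty_or_nonempty with h0 | ⟨A, hA⟩
      · rw [h0]; simp
      have hcard : (Clause.vars C).card = k := by
        rw [card_vars_of_falsified (Finset.mem_filter.1 hA).2.2, hF.1 C hCF]
      have hE : ((Clause.vars C).erase x) ⊆ V := by
        intro v hv
        rw [Finset.mem_erase] at hv
        exact (Finset.mem_insert.1 (hCV hv.2)).resolve_left hv.1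
      have hU : V \ Clause.vars C ∪ (Clause.vars C).erase x = V := by
        ext v
        have := @hE v
        simp only [Finset.mem_union, Finset.mem_sdiff, Finset.mem_erase] at this ⊢
        by_cases hvx : v = x
        · subst hvx; tauto
        · tauto
      have hg := grow (V \ Clause.vars C) ((Clause.vars C).erase x)
        (Finset.disjoint_left.2 fun v h1 h2 =>
          (Finset.mem_sdiff.1 h1).2 (Finset.mem_of_mem_erase h2)) hU.le
      rw [hU, Finset.card_erase_of_mem hxC, hcard] at hg
      refine le_trans ?_ hg
      rw [mul_comm]
      have : ((bad C).card : ℝ) ≤ (satSets F (V \ Clause.vars C)).card :=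
        mod_cast card_falsifying_le F hxC
      exact mul_le_mul_of_nonneg_left this (by positivity)
    have hcount : (2 : ℝ) * (satSets F V).card ≤
        (satSets F (insert x V)).card + ∑ C ∈ T, ((bad C).card : ℝ) := by
      have h1 := (card_extensions F hx).le.trans (Finset.card_le_card hcover)
      have h2 := h1.trans ((Finset.card_union_le _ _).trans
        (Nat.add_le_add_left Finset.card_biUnion_le _))
      exact mod_cast h2
    have hT : (T.card : ℝ) ≤ s := by
      have : T.card ≤ s := (Finset.card_filter_le _ _).trans (hF.2 x)
      exact mod_cast this
    have hpow : (0 : ℝ) < β ^ (k - 1) := by positivity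
    have hsum : (∑ C ∈ T, ((bad C).card : ℝ)) * β ^ (k - 1) ≤ s * (satSets F V).card := by
      rw [Finset.sum_mul]
      refine (Finset.sum_le_sum hbad).trans ?_
      rw [Finset.sum_const, nsmul_eq_mul]
      exact mul_le_mul_of_nonneg_right hT (by positivity)
    have hsum' : ∑ C ∈ T, ((bad C).card : ℝ) ≤ (2 - β) * (satSets F V).card := by
      refine le_of_mul_le_mul_right (hsum.trans ?_) hpow
      calc (s : ℝ) * (satSets F V).card ≤ (2 - β) * β ^ (k - 1) * (satSets F V).card :=
            mul_le_mul_of_nonneg_right hs (by positivity)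
        _ = _ := by ring
    linarith

theorem satisfiable_of_isKS {k s : ℕ} {F : Formula} (hk : 1 ≤ k) (hF : F.IsKS k s) {β : ℝ}
    (hβ : 0 < β) (hs : (s : ℝ) ≤ (2 - β) * β ^ (k - 1)) : F.Satisfiable := by
  classical
  have hpos : ∀ V : Finset ℕ, 0 < (satSets F V).card := by
    intro V
    induction V using Finset.induction_on with
    | empty =>
      refine Finset.card_pos.2 ⟨∅, mem_satSets.2 ⟨Finset.Subset.refl _, fun C hC hV => ?_⟩⟩
      have hne : C.Nonempty := Finset.card_pos.1 (by rw [hF.1 C hC]; omega)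
      obtain ⟨l, hl⟩ := hne
      exact absurd (hV (mem_vars_of_mem hl)) (Finset.notMem_empty _)
    | insert x V hx ih =>
      have h := mul_card_satSets_le hF hβ hs V x hx
      have : (0 : ℝ) < (satSets F (insert x V)).card := lt_of_lt_of_le (by positivity) h
      exact mod_cast this
  obtain ⟨A, hA⟩ := Finset.card_pos.1 (hpos (Formula.vars F))
  refine ⟨fun x => decide (x ∈ A), fun C hC => ?_⟩
  obtain ⟨l, hl, h⟩ := (mem_satSets.1 hA).2 C hC (Finset.subset_biUnion_of_mem Clause.vars hC)
  refine ⟨l, hl, ?_⟩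
  rw [SatLit] at h
  cases hb : l.2 <;> simp_all

/-- Take `β = 2 - 1 / k`. Bernoulli's inequality gives `(1 - 1 / (2 * k)) ^ (k - 1) ≥ 1 / 2`, hence
`(2 - β) * β ^ (k - 1) ≥ 2 ^ k / (4 * k)`. -/
theorem mem_satBounds_of_le {k s : ℕ} (hk : 1 ≤ k) (h : 4 * k * s ≤ 2 ^ k) : s ∈ satBounds k := by
  intro F hF
  have hk0 : (0 : ℝ) < k := by exact_mod_cast hk
  have hk1 : (1 : ℝ) ≤ k := by exact_mod_cast hk
  have hinv : (1 : ℝ) / k ≤ 1 := by rw [div_le_one hk0]; exact hk1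
  refine satisfiable_of_isKS hk hF (β := 2 - 1 / k) (by linarith) ?_
  have h1 : (1 : ℝ) / 2 ≤ (1 - 1 / (2 * k)) ^ (k - 1) := by
    have hb := one_add_mul_le_pow (a := -(1 / (2 * (k : ℝ)))) (by
      have : 1 / (2 * (k : ℝ)) ≤ 1 := by rw [div_le_one (by positivity)]; linarith
      linarith) (k - 1)
    rw [← sub_eq_add_neg] at hb
    refine le_trans ?_ hb
    rw [Nat.cast_sub hk, Nat.cast_one]
    have : ((k : ℝ) - 1) * (1 / (2 * k)) ≤ 1 / 2 := by
      rw [mul_one_div, div_le_div_iff₀ (by positivity) two_pos]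
      linarith
    linarith
  have h2 : (2 - 1 / (k : ℝ)) ^ (k - 1) = 2 ^ (k - 1) * (1 - 1 / (2 * k)) ^ (k - 1) := by
    rw [← mul_pow]
    congr 1
    field_simp
  have h3 : (4 : ℝ) * k * s ≤ 2 ^ (k - 1) * 2 := by
    rw [← pow_succ, Nat.sub_add_cancel hk]
    exact_mod_cast h
  rw [h2, sub_sub_cancel, one_div, inv_mul_eq_div, le_div_iff₀ hk0]
  nlinarith [mul_le_mul_of_nonneg_left h1 (by positivity : (0 : ℝ) ≤ 2 ^ (k - 1))]

end KSCNF

/-! ### Existence of the maxima and numerical bounds. -/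

namespace KSCNF

theorem Formula.IsKS.mono {k s t : ℕ} {F : Formula} (hF : F.IsKS k s) (h : s ≤ t) : F.IsKS k t :=
  ⟨hF.1, fun x => (hF.2 x).trans h⟩

theorem satBounds_subset (k : ℕ) : satBounds k ⊆ satBoundsMU1 k := fun _ hs F hF _ => hs F hF

theorem mem_upperBounds_of_mu1 {k d : ℕ} {F : Formula} (hF : F.IsKS k d) (hM : F.MU1) :
    d ∈ upperBounds (satBoundsMU1 k) := by
  intro s hs
  by_contra! h
  exact hM.1.1 (hs F (hF.mono h.le) hM)

/-- The complete binary tree of depth `k` gives the bound `2 ^ k`. -/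
theorem bddAbove_satBoundsMU1 {k : ℕ} (hk : 1 ≤ k) : BddAbove (satBoundsMU1 k) := by
  have hc : Constructible k (2 ^ k) (fun i => if i = k then 2 ^ k else 0) :=
    Constructible.of_kraft (by simp) (by simp)
  obtain ⟨F, hF, hM⟩ := hc.exists_mu1 hk fun i hi => if_neg hi.ne
  exact ⟨_, mem_upperBounds_of_mu1 hF hM⟩

theorem zero_mem_satBounds {k : ℕ} (hk : 1 ≤ k) : 0 ∈ satBounds k :=
  mem_satBounds_of_le hk (by simp)

theorem isGreatest_f {k : ℕ} (hk : 1 ≤ k) : IsGreatest (satBounds k) (f k) := by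
  have hb := (bddAbove_satBoundsMU1 hk).mono (satBounds_subset k)
  exact ⟨Nat.sSup_mem ⟨0, zero_mem_satBounds hk⟩ hb, fun s hs => le_csSup hb hs⟩

theorem isGreatest_f₁ {k : ℕ} (hk : 1 ≤ k) : IsGreatest (satBoundsMU1 k) (f₁ k) := by
  have hb := bddAbove_satBoundsMU1 hk
  exact ⟨Nat.sSup_mem ⟨0, satBounds_subset k (zero_mem_satBounds hk)⟩ hb,
    fun s hs => le_csSup hb hs⟩

theorem f_le_f₁ {k : ℕ} (hk : 1 ≤ k) : f k ≤ f₁ k :=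
  (isGreatest_f₁ hk).2 (satBounds_subset k (isGreatest_f hk).1)

theorem f₁_le {s k : ℕ} (hs : 20 ≤ s) (h : 2 ^ s ≤ k) : f₁ k ≤ 2 ^ (k - s) := by
  have hk : 1 ≤ k := Nat.one_le_two_pow.trans h
  obtain ⟨F, hF, hM⟩ :=
    (constructible_single_of_le hs h).exists_mu1 hk fun i hi => if_neg hi.ne
  exact mem_upperBounds_of_mu1 hF hM (isGreatest_f₁ hk).1

theorem f₁_le_div {s k : ℕ} (hs : 20 ≤ s) (h : 2 ^ s ≤ k) : (f₁ k : ℝ) ≤ 2 ^ k / 2 ^ s := by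
  have hsk : s ≤ k := Nat.lt_two_pow_self.le.trans h
  rw [le_div_iff₀ (by positivity)]
  calc (f₁ k : ℝ) * 2 ^ s ≤ 2 ^ (k - s) * 2 ^ s :=
        mul_le_mul_of_nonneg_right (mod_cast f₁_le hs h) (by positivity)
    _ = 2 ^ k := by rw [← pow_add, Nat.sub_add_cancel hsk]

theorem f₁_le_two_mul {k : ℕ} (hk : 2 ^ 20 ≤ k) : (f₁ k : ℝ) ≤ 2 * ((2 : ℝ) ^ k / k) := by
  have hk0 : k ≠ 0 := by
    rintro rfl
    norm_num at hk
  have hs : 20 ≤ Nat.log 2 k := Nat.le_log_of_pow_le one_lt_two hk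
  refine (f₁_le_div hs (Nat.pow_log_le_self 2 hk0)).trans ?_
  have h2 : (k : ℝ) ≤ 2 * 2 ^ Nat.log 2 k := by
    rw [← pow_succ']
    exact_mod_cast (Nat.lt_pow_succ_log_self one_lt_two k).le
  have hkpos : (0 : ℝ) < k := by exact_mod_cast Nat.pos_of_ne_zero hk0
  rw [← mul_div_assoc, div_le_div_iff₀ (by positivity) hkpos]
  nlinarith [mul_le_mul_of_nonneg_left h2 (by positivity : (0 : ℝ) ≤ 2 ^ k)]

theorem le_f {k : ℕ} (hk : 16 ≤ k) : (2 : ℝ) ^ k / k ≤ 8 * (f k : ℝ) := by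
  have hk1 : 1 ≤ k := by omega
  have hmem : 2 ^ k / (4 * k) ∈ satBounds k :=
    mem_satBounds_of_le hk1 (Nat.mul_div_le _ _)
  have h1 := (isGreatest_f hk1).2 hmem
  have hpow : 4 * k ≤ 2 ^ k := by
    clear h1 hmem
    induction k, hk using Nat.le_induction with
    | base => norm_num
    | succ n hn ih =>
      rw [pow_succ]
      have := ih (by omega)
      omega
  have h2 : 2 ^ k < (f k + 1) * (4 * k) :=
    (Nat.div_lt_iff_lt_mul (by omega)).1 (Nat.lt_succ_of_le h1)
  -- Positivity absorbs the rounding: `f k + 1 ≤ 2 * f k` turns the factor 4 into 8.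
  have h3 : 1 ≤ f k := le_trans (Nat.div_pos hpow (by omega)) h1
  rw [div_le_iff₀ (by exact_mod_cast hk1)]
  have h4 : 2 ^ k ≤ 8 * f k * k := by nlinarith
  exact_mod_cast h4

theorem isTheta_of_bounds {g h : ℕ → ℝ} (hg : ∀ k, 0 ≤ g k) (hh : ∀ k, 0 ≤ h k)
    (h1 : ∀ᶠ k in atTop, g k ≤ 2 * h k) (h2 : ∀ᶠ k in atTop, h k ≤ 8 * g k) :
    g =Θ[atTop] h := by
  refine ⟨IsBigO.of_bound 2 (h1.mono fun k hk => ?_), IsBigO.of_bound 8 (h2.mono fun k hk => ?_)⟩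
  all_goals rwa [Real.norm_of_nonneg (hg k), Real.norm_of_nonneg (hh k)]

end KSCNF

theorem corollary1p9 :
    (∀ k : ℕ, 1 ≤ k → IsGreatest (KSCNF.satBounds k) (KSCNF.f k)) ∧
    (∀ k : ℕ, 1 ≤ k → IsGreatest (KSCNF.satBoundsMU1 k) (KSCNF.f₁ k)) ∧
    (∀ᶠ k : ℕ in atTop, (KSCNF.f₁ k : ℝ) ≤ 2 * ((2 : ℝ) ^ k / (k : ℝ))) ∧
    ((fun k : ℕ => (KSCNF.f k : ℝ)) =Θ[atTop] fun k : ℕ => (2 : ℝ) ^ k / (k : ℝ)) ∧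
    ((fun k : ℕ => (KSCNF.f₁ k : ℝ)) =Θ[atTop] fun k : ℕ => (2 : ℝ) ^ k / (k : ℝ)) ∧
    {k : ℕ | (KSCNF.f₁ k : ℝ) ≤ (2 : ℝ) ^ k / (k : ℝ)}.Infinite := by
  have hupper : ∀ᶠ k : ℕ in atTop, (KSCNF.f₁ k : ℝ) ≤ 2 * ((2 : ℝ) ^ k / (k : ℝ)) :=
    (eventually_ge_atTop (2 ^ 20)).mono fun k hk => KSCNF.f₁_le_two_mul hk
  have hlower : ∀ᶠ k : ℕ in atTop, (2 : ℝ) ^ k / (k : ℝ) ≤ 8 * (KSCNF.f k : ℝ) :=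
    (eventually_ge_atTop 16).mono fun k hk => KSCNF.le_f hk
  have hle : ∀ᶠ k : ℕ in atTop, (KSCNF.f k : ℝ) ≤ KSCNF.f₁ k :=
    (eventually_ge_atTop 1).mono fun k hk => mod_cast KSCNF.f_le_f₁ hk
  refine ⟨fun k hk => KSCNF.isGreatest_f hk, fun k hk => KSCNF.isGreatest_f₁ hk, hupper,
    KSCNF.isTheta_of_bounds (fun _ => by positivity) (fun _ => by positivity) ?_ hlower,
    KSCNF.isTheta_of_bounds (fun _ => by positivity) (fun _ => by positivity) hupper ?_, ?_⟩
  · filter_upwards [hupper, hle] with k h1 h2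
    exact h2.trans h1
  · filter_upwards [hlower, hle] with k h1 h2
    linarith
  -- At powers of two, rounding `log₂ k` loses nothing.
  · refine Set.infinite_of_injective_forall_mem (f := fun s : ℕ => 2 ^ (s + 20))
      (fun a b hab => ?_) fun s => ?_
    · have := Nat.pow_right_injective le_rfl hab
      omega
    · have := KSCNF.f₁_le_div (s := s + 20) (by omega) le_rfl
      rw [Set.mem_ofPred_eq]
      push_cast
      exact this
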